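/- Let $H\in(0,1)$, $(a,b)\in\mathbb R^2\setminus\{(0,0)\}$ and $T>0$. On a probability space let $B^H=(B^H_t)_{t\in\mathbb R}$ be a fractional Brownian motion with Hurst index $H$ (a centered Gaussian process with stationary increments, $B^H_0=0$ a.s. and $\mathbb E[(B^H_t)^2]=|t|^{2H}$), and let $B=(B_t)_{t\in\mathbb R}$ be a two-sided Brownian motion independent of $B^H$ (only the finite-dimensional laws of $B$ matter; no path continuity is assumed). The sub-mixed fractional Brownian motion is $$S^H_t=\frac{a\,(B_t+B_{-t})+b\,(B^H_t+B^H_{-t})}{\sqrt2},\qquad t\ge 0 .$$ For a process $X=(X_t)_{0\le t\le T}$ let $\mathcal F^X_t=\sigma(X_s,\ 0\le s\le t)$. $X$ is a *weak semi-martingale* if the set of all random variables $\sum_{j=0}^{n-1} f_j\,(X_{t_{j+1}}-X_{t_j})$, where $n\in\mathbb N$, $0\le t_0\le\dots\le t_n\le T$, each $f_j$ is $\mathcal F^X_{t_j}$-measurable and $|f_j|\le 1$ a.s., is bounded in $L^0$, that is, in probability. $X$ is a *quasi-martingale* if $X_t\in L^1$ for all $t\in[0,T]$ and $$\sup\ \sum_{j=0}^{n-1}\big\|\mathbb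 E\big(X_{t_{j+1}}-X_{t_j}\,\big|\,\mathcal F^X_{t_j}\big)\big\|_1<\infty ,$$ the supremum being over all finite partitions $0=t_0<t_1<\dots<t_n=T$ of $[0,T]$. **Lemma.** If $(S^H_t)_{0\le t\le T}$ is not a quasi-martingale, then it is not a weak semi-martingale. -/

import Mathlib

open MeasureTheory ProbabilityTheory
open scoped NNReal ENNReal

namespace SubMixed

section Processes

/-- `B = (B_t)_{t ∈ ℝ}` is a fractional Brownian motion with Hurst index `H`: a centered Gaussian
process with stationary increments, `B_0 = 0` almost surely and `E (B_t ^ 2) = |t| ^ (2 H)`. -/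
structure IsFractionalBrownianMotion {Ω : Type*} [MeasurableSpace Ω]
    (H : ℝ) (B : ℝ → Ω → ℝ) (P : Measure Ω) : Prop where
  measurable : ∀ t, Measurable (B t)
  gaussian : IsGaussianProcess B P
  centered : ∀ t, ∫ ω, B t ω ∂P = 0
  stationary_increments : ∀ h : ℝ,
    IdentDistrib (fun ω (t : ℝ) => B (t + h) ω - B h ω) (fun ω (t : ℝ) => B t ω - B 0 ω) P P
  zero : ∀ᵐ ω ∂P, B 0 ω = 0
  second_moment : ∀ t : ℝ, ∫ ω, (B t ω) ^ 2 ∂P = |t| ^ (2 * H)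

/-- `B = (B_t)_{t ∈ ℝ}` has the law of a (two-sided) Brownian motion: `(B_t)_{t ≥ 0}` and
`(B_{-t})_{t ≥ 0}` are independent and each has the finite-dimensional laws of Brownian motion.
Continuity of paths is not required. -/
structure IsTwoSidedPreBrownian {Ω : Type*} [MeasurableSpace Ω]
    (B : ℝ → Ω → ℝ) (P : Measure Ω) : Prop where
  measurable : ∀ t, Measurable (B t)
  forward : IsPreBrownianReal (fun t : ℝ≥0 => B (t : ℝ)) P
  backward : IsPreBrownianReal (fun t : ℝ≥0 => B (-(t : ℝ))) P
  indep : IndepFun (fun ω (t : ℝ≥0) => B (t : ℝ) ω) (fun ω (t : ℝ≥0) => B (-(t : ℝ)) ω) P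

/-- The sub-mixed process `S_t = (a (B_t + B_{-t}) + b (BH_t + BH_{-t})) / √2`, `t ≥ 0`. -/
noncomputable def smfBm {Ω : Type*} (a b : ℝ) (B BH : ℝ → Ω → ℝ) (t : ℝ≥0) (ω : Ω) : ℝ :=
  (a * (B t ω + B (-(t : ℝ)) ω) + b * (BH t ω + BH (-(t : ℝ)) ω)) / √2

/-- The sub-mixed process restricted to the time interval `[0, T]`. -/
noncomputable def smfBmOn {Ω : Type*} (a b : ℝ) (B BH : ℝ → Ω → ℝ) (T : ℝ≥0)
    (t : Set.Icc (0 : ℝ≥0) T) (ω : Ω) : ℝ :=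
  smfBm a b B BH t ω

theorem stronglyMeasurable_smfBmOn {Ω : Type*} [MeasurableSpace Ω] (a b : ℝ) {B BH : ℝ → Ω → ℝ}
    (hB : ∀ t, Measurable (B t)) (hBH : ∀ t, Measurable (BH t)) (T : ℝ≥0)
    (t : Set.Icc (0 : ℝ≥0) T) : StronglyMeasurable (smfBmOn a b B BH T t) :=
  (((((hB _).add (hB _)).const_mul a).add (((hBH _).add (hBH _)).const_mul b)).div_const
    _).stronglyMeasurable

end Processes

section Semimartingales

/-- The elements `∑_{j < n} f_j 1_{]t_j, t_{j+1}]}` of `β(𝓕)`: `0 ≤ t_0 ≤ … ≤ t_n ≤ T`, each `f_j`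
is `𝓕_{t_j}`-measurable and `|f_j| ≤ 1` almost surely. -/
structure ElementaryIntegrand {Ω : Type*} {m : MeasurableSpace Ω} {T : ℝ≥0}
    (𝓕 : Filtration (Set.Icc (0 : ℝ≥0) T) m) (P : Measure Ω) where
  n : ℕ
  time : Fin (n + 1) → Set.Icc (0 : ℝ≥0) T
  time_mono : Monotone time
  coeff : Fin n → Ω → ℝ
  coeff_measurable : ∀ j, Measurable[𝓕 (time j.castSucc)] (coeff j)
  coeff_bound : ∀ j, ∀ᵐ ω ∂P, |coeff j ω| ≤ 1

/-- `I_X(θ) = ∑_{j < n} f_j (X_{t_{j+1}} - X_{t_j})`. -/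
def ElementaryIntegrand.integral {Ω : Type*} {m : MeasurableSpace Ω} {T : ℝ≥0}
    {𝓕 : Filtration (Set.Icc (0 : ℝ≥0) T) m} {P : Measure Ω} (θ : ElementaryIntegrand 𝓕 P)
    (X : Set.Icc (0 : ℝ≥0) T → Ω → ℝ) (ω : Ω) : ℝ :=
  ∑ j : Fin θ.n, θ.coeff j ω * (X (θ.time j.succ) ω - X (θ.time j.castSucc) ω)

/-- A set of random variables is bounded in `L⁰` (bounded in probability):
`sup_{Z ∈ A} P(|Z| > c) → 0` as `c → ∞`. -/
def BoundedInL0 {Ω : Type*} [MeasurableSpace Ω] (A : Set (Ω → ℝ)) (P : Measure Ω) : Prop :=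
  ∀ ε : ℝ≥0∞, 0 < ε → ∃ c : ℝ, ∀ Z ∈ A, P {ω | c < |Z ω|} ≤ ε

/-- `X` is a weak semi-martingale with respect to the filtration `𝓕`: it is `𝓕`-adapted and
`I_X(β(𝓕))` is bounded in `L⁰`. -/
def IsWeakSemimartingaleWrt {Ω : Type*} {m : MeasurableSpace Ω} {T : ℝ≥0}
    (X : Set.Icc (0 : ℝ≥0) T → Ω → ℝ) (𝓕 : Filtration (Set.Icc (0 : ℝ≥0) T) m)
    (P : Measure Ω) : Prop :=
  (∀ t, Measurable[𝓕 t] (X t)) ∧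
    BoundedInL0 (Set.range fun θ : ElementaryIntegrand 𝓕 P => θ.integral X) P

/-- `X` is a weak semi-martingale: it is one with respect to its own filtration
`𝓕^X_t = σ(X_s, s ≤ t)`. -/
def IsWeakSemimartingale {Ω : Type*} {m : MeasurableSpace Ω} {T : ℝ≥0}
    (X : Set.Icc (0 : ℝ≥0) T → Ω → ℝ) (hX : ∀ t, StronglyMeasurable (X t))
    (P : Measure Ω) : Prop :=
  IsWeakSemimartingaleWrt X (Filtration.natural X hX) P

/-- A finite partition `0 = t_0 < t_1 < … < t_n = T` of `[0, T]`. -/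
structure TimePartition (T : ℝ≥0) where
  n : ℕ
  time : Fin (n + 1) → Set.Icc (0 : ℝ≥0) T
  time_strictMono : StrictMono time
  time_zero : (time 0 : ℝ≥0) = 0
  time_last : (time (Fin.last n) : ℝ≥0) = T

/-- `X` is a quasi-martingale: every `X_t` is in `L¹`, and the supremum over all finite partitions
of `[0, T]` of `∑_j ‖E(X_{t_{j+1}} - X_{t_j} | 𝓕^X_{t_j})‖₁` is finite. -/
def IsQuasimartingale {Ω : Type*} {m : MeasurableSpace Ω} {T : ℝ≥0}
    (X : Set.Icc (0 : ℝ≥0) T → Ω → ℝ) (hX : ∀ t, StronglyMeasurable (X t))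
    (P : Measure Ω) : Prop :=
  (∀ t, MemLp (X t) 1 P) ∧
    (⨆ τ : TimePartition T, ∑ j : Fin τ.n,
      eLpNorm (P[X (τ.time j.succ) - X (τ.time j.castSucc) |
        Filtration.natural X hX (τ.time j.castSucc)]) 1 P) < ∞

end Semimartingales

end SubMixed

/-! The contrapositive holds for every centered Gaussian process $X$: a weak semi-martingale is a
quasi-martingale (`IsWeakSemimartingale.isQuasimartingale`). Two ingredients carry it.

Integrands: on paths staying within $c$ of their start, the quadratic variation is a boundary term
minus $2\sum y_j\,\Delta y_j$. Two elementary integrands therefore bound it in probability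
(`exists_measure_lt_sum_sq_le`). Once its expectation is bounded, the signs of $\xi_j =
E(\Delta_j\mid\mathcal F_{t_j})$ are used as integrand: $\sum|\xi_j|$ is an elementary integral
minus a sum of martingale differences bounded in $L^2$ (`exists_measure_lt_sum_condExp_le`).

Gaussianity: Gaussian powers satisfy a reverse Hölder inequality with a constant independent of the
variance, so one small enough exceedance probability already bounds the $L^1$ norm of a sum of such
powers, uniformly in the partition (`exists_sum_eLpNorm_le`). This turns both bounds in probability
into bounds in $L^1$. It applies to the $\xi_j$ because they are orthogonal projections in a
Gaussian Hilbert space (`isCenteredGaussian_condExp`). -/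

namespace SubMixed

/-! ### Gaussian subspaces of $L^2$ and conditional expectation as projection. -/

section GaussianSubspace

variable {Ω : Type*} {m : MeasurableSpace Ω} {P : Measure Ω}

/-- `Z` is a centered (possibly degenerate) Gaussian random variable. -/
def IsCenteredGaussian (Z : Ω → ℝ) (P : Measure Ω) : Prop :=
  ∃ v : ℝ≥0, HasLaw Z (gaussianReal 0 v) P

namespace IsCenteredGaussian

variable {Z Z' : Ω → ℝ}

theorem congr (h : IsCenteredGaussian Z P) (hZ : Z' =ᵐ[P] Z) : IsCenteredGaussian Z' P := by
  obtain ⟨v, hv⟩ := h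
  exact ⟨v, hv.congr hZ⟩

theorem hasGaussianLaw (h : IsCenteredGaussian Z P) : HasGaussianLaw Z P := by
  obtain ⟨v, hv⟩ := h
  exact hv.hasGaussianLaw

theorem integral_eq_zero (h : IsCenteredGaussian Z P) : ∫ ω, Z ω ∂P = 0 := by
  obtain ⟨v, hv⟩ := h
  rw [hv.integral_eq, integral_id_gaussianReal]

end IsCenteredGaussian

theorem isCenteredGaussian_of_hasGaussianLaw {Z : Ω → ℝ} (h : HasGaussianLaw Z P)
    (h0 : ∫ ω, Z ω ∂P = 0) : IsCenteredGaussian Z P :=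
  ⟨_, h.aemeasurable, by rw [h.map_eq_gaussianReal, h0]⟩

/-- A linear subspace of `L²` consisting of centered Gaussian variables is a Gaussian process
indexed by itself. -/
theorem isGaussianProcess_of_submodule (V : Submodule ℝ (Lp ℝ 2 P))
    (hV : ∀ f ∈ V, IsCenteredGaussian f P) :
    IsGaussianProcess (fun (f : V) ω => (f : Lp ℝ 2 P) ω) P where
  hasGaussianLaw I := by
    classical
    have hm : AEMeasurable (fun ω => I.restrict (fun f : V => (f : Lp ℝ 2 P) ω)) P :=
      aemeasurable_pi_lambda _ fun f => (Lp.aestronglyMeasurable _).aemeasurable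
    refine ⟨isGaussian_of_map_eq_gaussianReal fun L => ?_⟩
    -- The coordinates of `L` turn it into a linear combination of the process, which again lies in
    -- `V`.
    let c : I → ℝ := fun i => L (fun j => if i = j then 1 else 0)
    let g : V := ∑ i : I, c i • (i : V)
    obtain ⟨v, hv⟩ := hV g g.2
    refine ⟨0, v, ?_⟩
    rw [← hv.map_eq, AEMeasurable.map_map_of_aemeasurable (by fun_prop) hm]
    refine Measure.map_congr ?_
    have hg : (g : Lp ℝ 2 P) = ∑ i : I, c i • ((i : V) : Lp ℝ 2 P) := by simp [g]
    have h1 : ∀ᵐ ω ∂P, ∀ i : I,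
        (c i • ((i : V) : Lp ℝ 2 P) : Lp ℝ 2 P) ω = c i * ((i : V) : Lp ℝ 2 P) ω := by
      rw [ae_all_iff]
      intro i
      filter_upwards [Lp.coeFn_smul (c i) ((i : V) : Lp ℝ 2 P)] with ω hω
      simp [hω]
    filter_upwards [h1, Lp.coeFn_finsetSum Finset.univ
      (fun i : I => c i • ((i : V) : Lp ℝ 2 P))] with ω h1 h2
    rw [hg, h2]
    simp only [Function.comp_apply, Finset.sum_apply, h1]
    refine (LinearMap.pi_apply_eq_sum_univ (L : (I → ℝ) →ₗ[ℝ] ℝ) _).trans ?_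
    refine Finset.sum_congr rfl fun i _ => ?_
    simp [c, mul_comm]

variable [IsProbabilityMeasure P]

/-- The variance must be $\|f\|^2$, so the existential over variances becomes a family of equations
between characteristic functions, suited to passing to limits. -/
theorem isCenteredGaussian_coe_iff (f : Lp ℝ 2 P) :
    IsCenteredGaussian f P ↔
      ∀ t : ℝ, ∫ ω, Complex.exp (t * f ω * Complex.I) ∂P
        = Complex.exp (-((‖f‖ ^ 2 : ℝ) * t ^ 2 / 2 : ℂ)) := by
  have hm : AEMeasurable f P := (Lp.aestronglyMeasurable f).aemeasurable
  have hchar (t : ℝ) : charFun (P.map f) t = ∫ ω, Complex.exp (t * f ω * Complex.I) ∂P := by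
    rw [charFun_apply_real, integral_map hm (by fun_prop)]
  have hnorm : ‖f‖ ^ 2 = ∫ ω, f ω ^ 2 ∂P := by
    rw [← real_inner_self_eq_norm_sq, L2.inner_def]
    simp [pow_two]
  have : IsProbabilityMeasure (P.map f) := Measure.isProbabilityMeasure_map hm
  constructor
  · intro h t
    have h0 := h.integral_eq_zero
    have hv : Var[f; P] = ‖f‖ ^ 2 := by
      rw [variance_of_integral_eq_zero hm h0, hnorm]
    rw [← hchar, h.hasGaussianLaw.map_eq_gaussianReal, charFun_gaussianReal, h0, hv,
      Real.coe_toNNReal _ (by positivity)]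
    congr 1
    push_cast
    ring
  · intro h
    refine ⟨‖f‖₊ ^ 2, hm, Measure.ext_of_charFun (funext fun t => ?_)⟩
    rw [hchar, h, charFun_gaussianReal]
    congr 1
    push_cast
    simp

/-- For fixed $t$, $f\mapsto E\,e^{itf}$ is $|t|$-Lipschitz on $L^2$, since $|e^{ix}-1|\le|x|$ and
the $L^1$ norm is at most the $L^2$ norm. Both sides of the characteristic function identity are
thus continuous in $f$. -/
theorem isClosed_isCenteredGaussian : IsClosed {f : Lp ℝ 2 P | IsCenteredGaussian f P} := by
  simp_rw [isCenteredGaussian_coe_iff, Set.ofPred_forall]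
  refine isClosed_iInter fun t => isClosed_eq ?_ (by fun_prop)
  have hint (f : Lp ℝ 2 P) : Integrable (fun ω => Complex.exp (t * f ω * Complex.I)) P := by
    refine Integrable.of_bound (C := 1) ?_ (ae_of_all _ fun ω => ?_)
    · have := (Lp.aestronglyMeasurable f).aemeasurable
      exact AEMeasurable.aestronglyMeasurable (by fun_prop)
    · rw [← Complex.ofReal_mul, Complex.norm_exp_ofReal_mul_I]
  refine (LipschitzWith.of_dist_le_mul (K := ‖t‖₊) fun f g => ?_).continuous
  rw [dist_eq_norm, ← integral_sub (hint f) (hint g)]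
  have hfg : Integrable (fun ω => (f - g : Lp ℝ 2 P) ω) P :=
    (Lp.memLp (f - g)).integrable one_le_two
  calc ‖∫ ω, (Complex.exp (t * f ω * Complex.I) - Complex.exp (t * g ω * Complex.I)) ∂P‖
      ≤ ∫ ω, ‖Complex.exp (t * f ω * Complex.I) - Complex.exp (t * g ω * Complex.I)‖ ∂P :=
        norm_integral_le_integral_norm _
    _ ≤ ∫ ω, ‖t‖ * ‖(f - g : Lp ℝ 2 P) ω‖ ∂P := by
        refine integral_mono_ae ((hint f).sub (hint g)).norm (hfg.norm.const_mul _) ?_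
        filter_upwards [Lp.coeFn_sub f g] with ω hω
        have : Complex.exp (t * f ω * Complex.I) - Complex.exp (t * g ω * Complex.I)
            = Complex.exp ((t * g ω : ℝ) * Complex.I)
              * (Complex.exp (Complex.I * ((t * (f ω - g ω) : ℝ) : ℂ)) - 1) := by
          rw [mul_sub, ← Complex.exp_add, mul_one]
          push_cast
          ring_nf
        simp only [this, hω, Pi.sub_apply, norm_mul, Complex.norm_exp_ofReal_mul_I, one_mul]
        exact Real.norm_exp_I_mul_ofReal_sub_one_le.trans (norm_mul _ _).le
    _ = ‖t‖ * (eLpNorm (f - g : Lp ℝ 2 P) 1 P).toReal := by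
        rw [integral_const_mul, integral_norm_eq_lintegral_enorm hfg.1,
          eLpNorm_one_eq_lintegral_enorm]
    _ ≤ ‖t‖ * dist f g := by
        gcongr
        rw [dist_eq_norm, Lp.norm_def]
        exact ENNReal.toReal_mono (Lp.eLpNorm_ne_top _)
          (eLpNorm_le_eLpNorm_of_exponent_le one_le_two (Lp.aestronglyMeasurable _))

theorem aestronglyMeasurable_of_mem_closure_span {Ω : Type*} {F m : MeasurableSpace Ω}
    {P : Measure Ω} (hF : F ≤ m) {A : Set (Lp ℝ 2 P)} (hA : ∀ f ∈ A, AEStronglyMeasurable[F] f P)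
    {f : Lp ℝ 2 P} (hf : f ∈ (Submodule.span ℝ A).topologicalClosure) :
    AEStronglyMeasurable[F] f P := by
  refine closure_minimal ?_ (isClosed_aestronglyMeasurable (F := ℝ) (p := 2) (μ := P) hF) hf
  change (Submodule.span ℝ A : Set (Lp ℝ 2 P)) ⊆ (lpMeas ℝ ℝ F 2 P : Set (Lp ℝ 2 P))
  rw [SetLike.coe_subset_coe, Submodule.span_le]
  exact fun g hg => mem_lpMeas_iff_aestronglyMeasurable.2 (hA g hg)

/-- The conditional expectation of an increment of a centered Gaussian process, given some of its
values, is a centered Gaussian variable. -/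
theorem isCenteredGaussian_condExp {ι : Type*} {X : ι → Ω → ℝ} (hm : ∀ i, Measurable (X i))
    (hX : IsGaussianProcess X P) (h0 : ∀ i, ∫ ω, X i ω ∂P = 0) (S : Set ι) (u s : ι) :
    IsCenteredGaussian
      (P[X u - X s | ⨆ i : S, MeasurableSpace.comap (X i) (borel ℝ)]) P := by
  set F : MeasurableSpace Ω := ⨆ i : S, MeasurableSpace.comap (X i) (borel ℝ) with hF
  have hFm : F ≤ m := iSup_le fun i => by
    rw [← BorelSpace.measurable_eq (α := ℝ)]
    exact (hm i).comap_le
  have hL (i : ι) : MemLp (X i) 2 P := (hX.hasGaussianLaw_eval i).memLp_two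
  let x : ι → Lp ℝ 2 P := fun i => (hL i).toLp
  have hx (i : ι) : x i =ᵐ[P] X i := (hL i).coeFn_toLp
  let V : Submodule ℝ (Lp ℝ 2 P) := (Submodule.span ℝ (Set.range x)).topologicalClosure
  have hV : ∀ f ∈ V, IsCenteredGaussian f P := by
    intro f hf
    refine closure_minimal (fun g hg => ?_) isClosed_isCenteredGaussian hf
    obtain ⟨c, rfl⟩ := Finsupp.mem_span_range_iff_exists_finsupp.1 hg
    have hsum : ((c.sum fun i a => a • x i : Lp ℝ 2 P) : Ω → ℝ)
        =ᵐ[P] fun ω => ∑ i ∈ c.support, c i • X i ω := by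
      have h1 : ∀ᵐ ω ∂P, ∀ i ∈ c.support, (c i • x i : Lp ℝ 2 P) ω = c i • X i ω := by
        rw [Finset.eventually_all]
        intro i _
        filter_upwards [Lp.coeFn_smul (c i) (x i), hx i] with ω hω h2
        simp [hω, h2]
      filter_upwards [h1, Lp.coeFn_finsetSum c.support (fun i => c i • x i)] with ω h1 h2
      rw [Finsupp.sum, h2, Finset.sum_apply]
      exact Finset.sum_congr rfl h1
    refine IsCenteredGaussian.congr (isCenteredGaussian_of_hasGaussianLaw
      (hX.smul c).hasGaussianLaw_fun_sum ?_) hsum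
    simp only [smul_eq_mul]
    rw [integral_finsetSum _ fun i _ => ((hL i).integrable one_le_two).const_mul (c i)]
    simp [integral_const_mul, h0]
  -- `W` is the observed part of the Gaussian space `V`. The residual of the projection onto `W` is
  -- uncorrelated with each observed `X i` and jointly Gaussian with them, hence independent of `F`;
  -- so the conditional expectation is the projection `p`, an element of `V`.
  let W : Submodule ℝ (Lp ℝ 2 P) := (Submodule.span ℝ (x '' S)).topologicalClosure
  have hWV : W ≤ V := Submodule.topologicalClosure_mono
    (Submodule.span_mono (Set.image_subset_range _ _))
  have hxV (i : ι) : x i ∈ V :=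
    Submodule.le_topologicalClosure _ (Submodule.subset_span ⟨i, rfl⟩)
  have hxW (i : S) : x i ∈ W :=
    Submodule.le_topologicalClosure _ (Submodule.subset_span ⟨i, i.2, rfl⟩)
  have : CompleteSpace W := (Submodule.isClosed_topologicalClosure _).completeSpace_coe
  let d : Lp ℝ 2 P := x u - x s
  let p : Lp ℝ 2 P := W.starProjection d
  have hpW : p ∈ W := W.starProjection_apply_mem d
  have hrV : d - p ∈ V := V.sub_mem (V.sub_mem (hxV u) (hxV s)) (hWV hpW)
  have hr : d - p ∈ Wᗮ := W.sub_starProjection_mem_orthogonal d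
  have hpF : AEStronglyMeasurable[F] p P := by
    refine aestronglyMeasurable_of_mem_closure_span hFm ?_ hpW
    rintro _ ⟨i, hi, rfl⟩
    refine ⟨X i, ?_, hx i⟩
    refine Measurable.stronglyMeasurable ?_
    rw [measurable_iff_comap_le, BorelSpace.measurable_eq (α := ℝ)]
    exact le_iSup (fun i : S => MeasurableSpace.comap (X i) (borel ℝ)) ⟨i, hi⟩
  have hindep : Indep (MeasurableSpace.comap ((d - p : Lp ℝ 2 P) : Ω → ℝ) inferInstance) F P := by
    have hjoint : IsGaussianProcess (Sum.elim (fun (_ : Unit) => ((d - p : Lp ℝ 2 P) : Ω → ℝ))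
        (fun i : S => X i)) P := by
      refine ((isGaussianProcess_of_submodule V hV).comp_right
        (Sum.elim (fun _ : Unit => ⟨d - p, hrV⟩) fun i : S => ⟨x i, hxV i⟩)).congr ?_
      rintro (_ | i)
      · rfl
      · exact hx i
    have h := hjoint.indepFun_of_covariance_eq_zero
      (fun _ => (Lp.aestronglyMeasurable _).aemeasurable) (fun i => (hm i).aemeasurable) ?_
    · rw [IndepFun_iff_Indep] at h
      refine indep_of_indep_of_le_right (indep_of_indep_of_le_left h ?_) ?_
      · rw [← measurable_iff_comap_le]
        exact (measurable_pi_apply ()).comp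
          (comap_measurable (fun ω (_ : Unit) => (d - p : Lp ℝ 2 P) ω))
      · refine iSup_le fun i => ?_
        rw [← BorelSpace.measurable_eq (α := ℝ), ← measurable_iff_comap_le]
        exact (measurable_pi_apply i).comp (comap_measurable (fun ω (i : S) => X i ω))
    · intro _ i
      have h1 : inner ℝ (x i) (d - p) = 0 := hr _ (hxW i)
      rw [covariance_eq_sub (Lp.memLp _) (hL i), h0 i, mul_zero, sub_zero]
      rw [L2.inner_def] at h1
      rw [← h1]
      refine integral_congr_ae ?_
      filter_upwards [hx i] with ω hω
      simp [hω]
  have hrint : Integrable ((d - p : Lp ℝ 2 P) : Ω → ℝ) P := (Lp.memLp _).integrable one_le_two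
  have hpint : Integrable (p : Ω → ℝ) P := (Lp.memLp _).integrable one_le_two
  have hr0 : P[((d - p : Lp ℝ 2 P) : Ω → ℝ) | F] =ᵐ[P] 0 := by
    have h := condExp_indep_eq (μ := P)
      (Lp.stronglyMeasurable (d - p)).measurable.comap_le hFm
      (comap_measurable _).stronglyMeasurable hindep
    filter_upwards [h] with ω hω
    rw [hω, (hV _ hrV).integral_eq_zero, Pi.zero_apply]
  have hdecomp : X u - X s =ᵐ[P] ((d - p : Lp ℝ 2 P) : Ω → ℝ) + (p : Ω → ℝ) := by
    filter_upwards [Lp.coeFn_sub d p, Lp.coeFn_sub (x u) (x s), hx u, hx s] with ω h1 h2 h3 h4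
    simp only [Pi.add_apply, Pi.sub_apply] at h1 h2 ⊢
    rw [h1, sub_add_cancel, h2, h3, h4]
  refine (hV p (hWV hpW)).congr ?_
  filter_upwards [condExp_congr_ae (m := F) hdecomp, condExp_add hrint hpint F, hr0,
    condExp_of_aestronglyMeasurable' hFm hpF hpint] with ω h1 h2 h3 h4
  rw [h1, h2, Pi.add_apply, h3, h4, Pi.zero_apply, zero_add]

end GaussianSubspace

/-! ### Reverse Hölder inequality for Gaussian powers. -/

section ReverseHolder

variable {Ω : Type*} {m : MeasurableSpace Ω} {P : Measure Ω}

theorem eLpNorm_abs_pow_gaussianReal (k : ℕ) (v : ℝ≥0) (p : ℝ≥0∞) :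
    eLpNorm (fun x : ℝ => |x| ^ k) p (gaussianReal 0 v)
      = ‖(√(v : ℝ)) ^ k‖ₑ * eLpNorm (fun x : ℝ => |x| ^ k) p (gaussianReal 0 1) := by
  have h : gaussianReal 0 v = (gaussianReal 0 1).map (fun x => √(v : ℝ) * x) := by
    rw [gaussianReal_map_const_mul]
    congr 1
    · simp
    · ext; simp
  rw [h, eLpNorm_map_measure (by fun_prop) (by fun_prop), ← eLpNorm_const_smul]
  congr 1
  ext x
  simp [abs_mul, mul_pow, abs_of_nonneg (Real.sqrt_nonneg _)]

theorem memLp_abs_pow_gaussianReal (k : ℕ) (v : ℝ≥0) :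
    MemLp (fun x : ℝ => |x| ^ k) 2 (gaussianReal 0 v) := by
  rw [memLp_two_iff_integrable_sq (by fun_prop)]
  have := (memLp_id_gaussianReal' (μ := 0) (v := v) ((2 * k : ℕ) : ℝ≥0∞)
    (ENNReal.natCast_ne_top _)).integrable_norm_pow'
  refine this.congr (ae_of_all _ fun x => ?_)
  simp [← pow_mul, mul_comm]

/-- By scaling, the variance contributes the same factor to both norms, so the ratio of the norms
for the standard Gaussian serves for every `v`. -/
theorem exists_reverse_holder_gaussianReal (k : ℕ) :
    ∃ C : ℝ≥0∞, C ≠ ∞ ∧ ∀ v : ℝ≥0, eLpNorm (fun x : ℝ => |x| ^ k) 2 (gaussianReal 0 v)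
      ≤ C * eLpNorm (fun x : ℝ => |x| ^ k) 1 (gaussianReal 0 v) := by
  set A := eLpNorm (fun x : ℝ => |x| ^ k) 2 (gaussianReal 0 1) with hA
  set B := eLpNorm (fun x : ℝ => |x| ^ k) 1 (gaussianReal 0 1) with hB
  have hA' : A ≠ ∞ := (memLp_abs_pow_gaussianReal k 1).2.ne
  have hB0 : B ≠ 0 := by
    rw [hB, Ne, eLpNorm_eq_zero_iff (by fun_prop) one_ne_zero]
    intro h
    have : NullSingletonClass (gaussianReal 0 1) := nullSingletonClass_gaussianReal one_ne_zero
    have h0 : ∀ᵐ x ∂(gaussianReal 0 1), x ≠ 0 := by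
      simp [ae_iff]
    obtain ⟨x, h1, h2⟩ := (h.and h0).exists
    exact h2 (by simpa using eq_zero_of_pow_eq_zero h1)
  have hB' : B ≠ ∞ := ((memLp_abs_pow_gaussianReal k 1).mono_exponent one_le_two).2.ne
  refine ⟨A / B, ENNReal.div_ne_top hA' hB0, fun v => ?_⟩
  rw [eLpNorm_abs_pow_gaussianReal k v 2, eLpNorm_abs_pow_gaussianReal k v 1, ← hA, ← hB,
    mul_left_comm, ENNReal.div_mul_cancel hB0 hB']

theorem eLpNorm_abs_pow_of_hasLaw {Z : Ω → ℝ} {v : ℝ≥0}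
    (h : HasLaw Z (gaussianReal 0 v) P) (k : ℕ) (p : ℝ≥0∞) :
    eLpNorm (fun ω => |Z ω| ^ k) p P = eLpNorm (fun x : ℝ => |x| ^ k) p (gaussianReal 0 v) := by
  rw [← h.map_eq, eLpNorm_map_measure (by fun_prop) h.aemeasurable]
  rfl

theorem IsCenteredGaussian.memLp_abs_pow {Z : Ω → ℝ} (h : IsCenteredGaussian Z P) (k : ℕ) :
    MemLp (fun ω => |Z ω| ^ k) 2 P := by
  obtain ⟨v, hv⟩ := h
  have := hv.aemeasurable
  refine ⟨AEMeasurable.aestronglyMeasurable (by fun_prop), ?_⟩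
  rw [eLpNorm_abs_pow_of_hasLaw hv]
  exact (memLp_abs_pow_gaussianReal k v).2

/-- A variable whose `L²` norm is controlled by its `L¹` norm has its `L¹` norm controlled by its
quantiles. -/
theorem eLpNorm_one_le_of_measure_lt_le {Y : Ω → ℝ} [IsProbabilityMeasure P] (hY : MemLp Y 2 P)
    {C δ : ℝ≥0∞} (hC : eLpNorm Y 2 P ≤ C * eLpNorm Y 1 P) (hδ : C * δ ^ (1 / 2 : ℝ) ≤ 1 / 2)
    {K : ℝ≥0} (hK : P {ω | (K : ℝ) < |Y ω|} ≤ δ) :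
    eLpNorm Y 1 P ≤ 2 * K := by
  set A : Set Ω := {ω | (K : ℝ≥0∞) < ‖Y ω‖ₑ}
  have hAK : P A ≤ δ := by
    convert hK using 3
    ext ω
    rw [enorm_eq_nnnorm, ENNReal.coe_lt_coe, ← NNReal.coe_lt_coe, coe_nnnorm, Real.norm_eq_abs]
  have hA : NullMeasurableSet A P := nullMeasurableSet_lt (by fun_prop) hY.1.enorm
  -- By Cauchy–Schwarz the rare event `A` carries at most half of the $L^1$ norm; this half is
  -- absorbed below, which requires that norm to be finite.
  have h1 : ∫⁻ ω in A, ‖Y ω‖ₑ ∂P ≤ eLpNorm Y 1 P / 2 := by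
    calc ∫⁻ ω in A, ‖Y ω‖ₑ ∂P = eLpNorm Y 1 (P.restrict A) := eLpNorm_one_eq_lintegral_enorm.symm
      _ ≤ eLpNorm Y 2 (P.restrict A) * (P.restrict A) Set.univ
            ^ (1 / (1 : ℝ≥0∞).toReal - 1 / (2 : ℝ≥0∞).toReal) :=
          eLpNorm_le_eLpNorm_mul_rpow_measure_univ one_le_two hY.1.restrict
      _ ≤ eLpNorm Y 2 P * δ ^ (1 / 2 : ℝ) := by
          have : (1 / (1 : ℝ≥0∞).toReal - 1 / (2 : ℝ≥0∞).toReal : ℝ) = 1 / 2 := by norm_num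
          rw [this, Measure.restrict_apply_univ]
          gcongr
          exact Measure.restrict_le_self
      _ ≤ (C * eLpNorm Y 1 P) * δ ^ (1 / 2 : ℝ) := by gcongr
      _ = (C * δ ^ (1 / 2 : ℝ)) * eLpNorm Y 1 P := by ring
      _ ≤ (1 / 2) * eLpNorm Y 1 P := by gcongr
      _ = eLpNorm Y 1 P / 2 := by rw [one_div, mul_comm, ENNReal.div_eq_inv_mul, mul_comm]
  have h2 : ∫⁻ ω in Aᶜ, ‖Y ω‖ₑ ∂P ≤ K := by
    calc ∫⁻ ω in Aᶜ, ‖Y ω‖ₑ ∂P ≤ ∫⁻ _ in Aᶜ, (K : ℝ≥0∞) ∂P := by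
          refine lintegral_mono_ae ((ae_restrict_iff'₀ hA.compl).2 (ae_of_all _ fun ω hω => ?_))
          simpa [A] using hω
      _ ≤ K := by
          rw [lintegral_const, Measure.restrict_apply_univ]
          exact mul_le_of_le_one_right' prob_le_one
  have hfin : eLpNorm Y 1 P ≠ ∞ := (hY.mono_exponent one_le_two).2.ne
  have h3 : eLpNorm Y 1 P ≤ eLpNorm Y 1 P / 2 + K := by
    calc eLpNorm Y 1 P = ∫⁻ ω in A, ‖Y ω‖ₑ ∂P + ∫⁻ ω in Aᶜ, ‖Y ω‖ₑ ∂P := by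
          rw [eLpNorm_one_eq_lintegral_enorm, ← lintegral_add_measure,
            ← Measure.restrict_union₀ disjoint_compl_right.aedisjoint hA.compl,
            Set.union_compl_self, Measure.restrict_univ]
      _ ≤ _ := add_le_add h1 h2
  have h4 : eLpNorm Y 1 P / 2 ≤ K := by
    rw [← ENNReal.add_le_add_iff_left (a := eLpNorm Y 1 P / 2)
      (ENNReal.div_ne_top hfin two_ne_zero), ENNReal.add_halves]
    exact h3
  calc eLpNorm Y 1 P = 2 * (eLpNorm Y 1 P / 2) := by
        rw [ENNReal.mul_div_cancel two_ne_zero ENNReal.ofNat_ne_top]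
    _ ≤ 2 * K := by gcongr

/-- Sums of powers of Gaussian variables are bounded in `L¹` as soon as they are bounded with
large probability. -/
theorem exists_sum_eLpNorm_le (k : ℕ) (P : Measure Ω) [IsProbabilityMeasure P] :
    ∃ δ : ℝ≥0∞, 0 < δ ∧ ∀ (n : ℕ) (Z : Fin n → Ω → ℝ), (∀ j, IsCenteredGaussian (Z j) P) →
      ∀ K : ℝ≥0, P {ω | (K : ℝ) < ∑ j, |Z j ω| ^ k} ≤ δ →
        ∑ j, eLpNorm (fun ω => |Z j ω| ^ k) 1 P ≤ 2 * K := by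
  obtain ⟨C, hC, hCv⟩ := exists_reverse_holder_gaussianReal k
  -- Chosen so that $C\sqrt\delta\le 1/2$; `C + 1` avoids dividing by zero.
  refine ⟨(1 / 2 / (C + 1)) ^ (2 : ℝ), ?_, fun n Z hZ K hK => ?_⟩
  · refine ENNReal.rpow_pos ?_ ?_
    · exact ENNReal.div_pos (by simp) (by simp [hC])
    · exact ENNReal.div_ne_top (by simp) (by simp)
  have hmem (j : Fin n) := (hZ j).memLp_abs_pow k
  have hsum : eLpNorm (fun ω => ∑ j, |Z j ω| ^ k) 1 P
      = ∑ j, eLpNorm (fun ω => |Z j ω| ^ k) 1 P := by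
    simp only [eLpNorm_one_eq_lintegral_enorm]
    rw [← lintegral_finsetSum' _ fun j _ => (hmem j).1.enorm]
    refine lintegral_congr fun ω => ?_
    rw [Real.enorm_of_nonneg (by positivity), ENNReal.ofReal_sum_of_nonneg (by intros; positivity)]
    exact Finset.sum_congr rfl fun j _ => (Real.enorm_of_nonneg (by positivity)).symm
  have hY : MemLp (fun ω => ∑ j, |Z j ω| ^ k) 2 P := memLp_finsetSum _ fun j _ => hmem j
  rw [← hsum]
  -- The constant `C` survives summation, whatever `n` and the dependence between the terms:
  -- Minkowski in $L^2$, and additivity of the $L^1$ norm on nonnegative functions.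
  refine eLpNorm_one_le_of_measure_lt_le hY (C := C) ?_ ?_ (le_trans (le_of_eq ?_) hK)
  · rw [hsum, Finset.mul_sum]
    have : (fun ω => ∑ j, |Z j ω| ^ k) = ∑ j, fun ω => |Z j ω| ^ k := by ext; simp
    rw [this]
    refine (eLpNorm_sum_le (fun j _ => (hmem j).1) one_le_two).trans
      (Finset.sum_le_sum fun j _ => ?_)
    obtain ⟨v, hv⟩ := hZ j
    rw [eLpNorm_abs_pow_of_hasLaw hv, eLpNorm_abs_pow_of_hasLaw hv]
    exact hCv v
  · rw [← ENNReal.rpow_mul, mul_one_div_cancel two_ne_zero, ENNReal.rpow_one]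
    calc C * (1 / 2 / (C + 1)) ≤ (C + 1) * (1 / 2 / (C + 1)) := mul_le_mul_left le_self_add _
      _ = 1 / 2 := ENNReal.mul_div_cancel (by simp) (by simp [hC])
  · congr 1
    ext ω
    rw [Set.mem_ofPred_eq, Set.mem_ofPred_eq, abs_of_nonneg (by positivity)]

end ReverseHolder

/-! ### Pathwise identities for finite sequences. -/

section Deterministic

theorem forall_le_castSucc_iff {n : ℕ} {p : Fin (n + 1) → Prop} {k : Fin n} :
    (∀ i ≤ k.castSucc, p i) ↔ ∀ i ≤ k, p i.castSucc := by
  refine ⟨fun h i hi => h _ (by simpa using hi), fun h i hi => ?_⟩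
  have hi' : (i : ℕ) ≤ k := hi
  exact h ⟨i, by omega⟩ hi'

open Classical in
/-- Summing the increments of a finite path up to the first time it leaves `[-c, c]` gives either
the final value or a value outside `[-c, c]`. -/
theorem stopped_sum_increments (c : ℝ) : ∀ (n : ℕ) (y : Fin (n + 1) → ℝ), y 0 = 0 →
    ((∀ i, |y i| ≤ c) ∧ ∑ j : Fin n, (if ∀ i ≤ j.castSucc, |y i| ≤ c then (1 : ℝ) else 0)
        * (y j.succ - y j.castSucc) = y (Fin.last n)) ∨
    ((¬ ∀ i, |y i| ≤ c) ∧ c < |∑ j : Fin n, (if ∀ i ≤ j.castSucc, |y i| ≤ c then (1 : ℝ) else 0)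
        * (y j.succ - y j.castSucc)|)
  | 0, y, h0 => by
    by_cases hc : 0 ≤ c <;> simp [Fin.forall_fin_one, h0, hc, not_le.1]
  | n + 1, y, h0 => by
    have ih := stopped_sum_increments c n (fun i => y i.castSucc) h0
    rw [Fin.sum_univ_castSucc]
    have hlast : (∀ i ≤ (Fin.last n).castSucc, |y i| ≤ c) ↔
        ∀ i : Fin (n + 1), |y i.castSucc| ≤ c := by
      rw [forall_le_castSucc_iff]
      exact ⟨fun h i => h i (Fin.le_last i), fun h i _ => h i⟩
    simp only [forall_le_castSucc_iff (p := fun i => |y i| ≤ c), Fin.succ_castSucc, Fin.succ_last,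
      Fin.le_last, true_implies] at ih ⊢
    rcases ih with ⟨h1, h2⟩ | ⟨h1, h2⟩
    · rw [h2, if_pos h1]
      have hs : y (Fin.last n).castSucc + 1 * (y (Fin.last (n + 1)) - y (Fin.last n).castSucc)
          = y (Fin.last (n + 1)) := by ring
      rw [hs, Fin.forall_fin_succ']
      by_cases hl : |y (Fin.last (n + 1))| ≤ c
      · exact Or.inl ⟨⟨h1, hl⟩, rfl⟩
      · exact Or.inr ⟨fun h => hl h.2, not_le.1 hl⟩
    · rw [if_neg h1, zero_mul, add_zero]
      exact Or.inr ⟨fun h => h1 fun i => h _, h2⟩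

/-- Discrete Itô formula for $y^2$: it trades the quadratic variation for an integral of the path
against itself. -/
theorem sum_sq_increments : ∀ (n : ℕ) (y : Fin (n + 1) → ℝ),
    ∑ j : Fin n, (y j.succ - y j.castSucc) ^ 2 = y (Fin.last n) ^ 2 - y 0 ^ 2
      - 2 * ∑ j : Fin n, y j.castSucc * (y j.succ - y j.castSucc)
  | 0, y => by simp
  | n + 1, y => by
    have ih := sum_sq_increments n (fun i => y i.castSucc)
    rw [Fin.sum_univ_castSucc, Fin.sum_univ_castSucc]
    simp only [Fin.succ_castSucc, Fin.succ_last, Fin.castSucc_zero] at ih ⊢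
    rw [ih]
    ring

end Deterministic

/-! ### From weak semi-martingale to quasi-martingale. -/

section WeakSemimartingale

variable {Ω : Type*} {m : MeasurableSpace Ω} {P : Measure Ω} {T : ℝ≥0}
  {X : Set.Icc (0 : ℝ≥0) T → Ω → ℝ} {𝓕 : Filtration (Set.Icc (0 : ℝ≥0) T) m}

theorem IsWeakSemimartingaleWrt.exists_measure_lt_integral_le (h : IsWeakSemimartingaleWrt X 𝓕 P)
    {ε : ℝ≥0∞} (hε : 0 < ε) :
    ∃ c : ℝ≥0, 0 < c ∧
      ∀ θ : ElementaryIntegrand 𝓕 P, P {ω | (c : ℝ) < |θ.integral X ω|} ≤ ε := by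
  obtain ⟨c, hc⟩ := h.2 ε hε
  refine ⟨max c.toNNReal 1, by simp, fun θ => (measure_mono fun ω hω => ?_).trans (hc _ ⟨θ, rfl⟩)⟩
  simp only [Set.mem_ofPred_eq] at hω ⊢
  refine lt_of_le_of_lt ?_ hω
  exact (Real.le_coe_toNNReal c).trans (NNReal.coe_le_coe.2 (le_max_left _ _))

/-- The quadratic variations of a weak semi-martingale along partitions are bounded in
probability. -/
theorem IsWeakSemimartingaleWrt.exists_measure_lt_sum_sq_le (h : IsWeakSemimartingaleWrt X 𝓕 P)
    {ε : ℝ≥0∞} (hε : 0 < ε) :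
    ∃ K : ℝ≥0, ∀ (n : ℕ) (t : Fin (n + 1) → Set.Icc (0 : ℝ≥0) T), Monotone t →
      P {ω | (K : ℝ) < ∑ j : Fin n, |X (t j.succ) ω - X (t j.castSucc) ω| ^ 2} ≤ ε := by
  classical
  obtain ⟨c, hc0, hc⟩ := h.exists_measure_lt_integral_le (ENNReal.half_pos hε.ne')
  have hc0' : (0 : ℝ) < c := hc0
  -- One $c^2$ bounds the squared final value of `y`, and $2c^2$ bounds twice $|\sum y_j\,\Delta
  -- y_j|$.
  refine ⟨3 * c ^ 2, fun n t ht => ?_⟩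
  let y : Fin (n + 1) → Ω → ℝ := fun i ω => X (t i) ω - X (t 0) ω
  have hy {i j : Fin (n + 1)} (hij : i ≤ j) : Measurable[𝓕 (t j)] (y i) :=
    ((h.1 (t i)).mono (𝓕.mono (ht hij)) le_rfl).sub
      ((h.1 (t 0)).mono (𝓕.mono (ht (Fin.zero_le j))) le_rfl)
  have hyabs {i j : Fin (n + 1)} (hij : i ≤ j) :
      MeasurableSet[𝓕 (t j)] {ω | |y i ω| ≤ c} := by
    have h1 : {ω | |y i ω| ≤ c} = y i ⁻¹' Set.Icc (-c) c := by ext ω; simp [abs_le]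
    rw [h1]
    exact hy hij measurableSet_Icc
  -- Stops at the first exit from $[-c,c]$, the exit increment included, so a path that leaves has
  -- $|I(\theta_1)|>c$.
  let θ₁ : ElementaryIntegrand 𝓕 P :=
    { n := n
      time := t
      time_mono := ht
      coeff := fun j ω => if ∀ i ≤ j.castSucc, |y i ω| ≤ c then 1 else 0
      coeff_measurable := fun j => by
        refine Measurable.ite ?_ measurable_const measurable_const
        simp only [Set.ofPred_forall]
        exact MeasurableSet.iInter fun i => MeasurableSet.iInter fun hi => hyabs hi
      coeff_bound := fun j => ae_of_all _ fun ω => by split_ifs <;> simp }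
  -- The integrand $y/c$, cut off to respect the bound 1; the cutoff is inactive on paths that never
  -- leave $[-c,c]$.
  let θ₂ : ElementaryIntegrand 𝓕 P :=
    { n := n
      time := t
      time_mono := ht
      coeff := fun j ω => if |y j.castSucc ω| ≤ c then (c : ℝ)⁻¹ * y j.castSucc ω else 0
      coeff_measurable := fun j =>
        Measurable.ite (hyabs le_rfl) ((hy le_rfl).const_mul _) measurable_const
      coeff_bound := fun j => ae_of_all _ fun ω => by
        split_ifs with hle
        · rw [abs_mul, abs_inv, abs_of_pos hc0', inv_mul_le_iff₀ hc0']
          simpa using hle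
        · simp }
  have hincr (j : Fin n) (ω : Ω) :
      X (t j.succ) ω - X (t j.castSucc) ω = y j.succ ω - y j.castSucc ω := by simp [y]
  have hI₁ (ω : Ω) : θ₁.integral X ω = ∑ j : Fin n,
      (if ∀ i ≤ j.castSucc, |y i ω| ≤ c then (1 : ℝ) else 0)
        * (y j.succ ω - y j.castSucc ω) :=
    Finset.sum_congr rfl fun j _ => by rw [← hincr]
  have hI₂ (ω : Ω) : θ₂.integral X ω = ∑ j : Fin n,
      (if |y j.castSucc ω| ≤ c then (c : ℝ)⁻¹ * y j.castSucc ω else 0)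
        * (y j.succ ω - y j.castSucc ω) :=
    Finset.sum_congr rfl fun j _ => by rw [← hincr]
  calc P {ω | ((3 * c ^ 2 : ℝ≥0) : ℝ) < ∑ j : Fin n, |X (t j.succ) ω - X (t j.castSucc) ω| ^ 2}
      ≤ P ({ω | (c : ℝ) < |θ₁.integral X ω|} ∪ {ω | (c : ℝ) < |θ₂.integral X ω|}) := by
        refine measure_mono fun ω hω => ?_
        by_contra hcon
        simp only [Set.mem_union, Set.mem_ofPred_eq, not_or, not_lt] at hcon hω
        obtain ⟨h1, h2⟩ := hcon
        rw [hI₁] at h1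
        rw [hI₂] at h2
        have hle : ∀ i, |y i ω| ≤ c := by
          rcases stopped_sum_increments c n (fun i => y i ω) (by simp [y]) with h3 | h3
          · exact h3.1
          · exact absurd h1 (not_le.2 h3.2)
        simp only [hle, if_true, mul_assoc] at h2
        rw [← Finset.mul_sum, abs_mul, abs_inv, abs_of_pos hc0', inv_mul_le_iff₀ hc0'] at h2
        have h4 := sum_sq_increments n (fun i => y i ω)
        have h5 : y (Fin.last n) ω ^ 2 ≤ c ^ 2 :=
          sq_le_sq' (abs_le.1 (hle _)).1 (abs_le.1 (hle _)).2
        simp only [sq_abs, hincr] at hω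
        rw [h4] at hω
        push_cast at hω
        have := (abs_le.1 h2).1
        nlinarith [sq_nonneg (y 0 ω)]
    _ ≤ ε / 2 + ε / 2 := (measure_union_le _ _).trans (add_le_add (hc θ₁) (hc θ₂))
    _ = ε := ENNReal.add_halves ε

theorem lintegral_enorm_sq_eq_eLpNorm_sq (f : Ω → ℝ) :
    ∫⁻ ω, ‖f ω‖ₑ ^ 2 ∂P = eLpNorm f 2 P ^ 2 := by
  have := eLpNorm_nnreal_pow_eq_lintegral (μ := P) (f := f) (p := 2) two_ne_zero
  simpa using this.symm

theorem lintegral_enorm_sq_eq_ofReal {f : Ω → ℝ} (hf : MemLp f 2 P) :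
    ∫⁻ ω, ‖f ω‖ₑ ^ 2 ∂P = ENNReal.ofReal (∫ ω, f ω ^ 2 ∂P) := by
  rw [ofReal_integral_eq_lintegral_ofReal hf.integrable_sq (ae_of_all _ fun ω => sq_nonneg _)]
  refine lintegral_congr fun ω => ?_
  rw [← sq_abs, ENNReal.ofReal_pow (abs_nonneg _), ← Real.norm_eq_abs, ofReal_norm]

theorem lintegral_enorm_sum_sq_of_orthogonal {n : ℕ} {g : Fin n → Ω → ℝ}
    (hg : ∀ j, MemLp (g j) 2 P) (horth : ∀ i j, i < j → ∫ ω, g i ω * g j ω ∂P = 0) :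
    ∫⁻ ω, ‖∑ j, g j ω‖ₑ ^ 2 ∂P = ∑ j, ∫⁻ ω, ‖g j ω‖ₑ ^ 2 ∂P := by
  have hint (i j : Fin n) : Integrable (fun ω => g i ω * g j ω) P := (hg i).integrable_mul (hg j)
  have h0 (i j : Fin n) (hij : i ≠ j) : ∫ ω, g i ω * g j ω ∂P = 0 := by
    rcases lt_or_gt_of_ne hij with h | h
    · exact horth i j h
    · simpa only [mul_comm] using horth j i h
  rw [lintegral_enorm_sq_eq_ofReal (memLp_finsetSum _ fun j _ => hg j)]
  simp_rw [lintegral_enorm_sq_eq_ofReal (hg _)]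
  rw [← ENNReal.ofReal_sum_of_nonneg fun j _ => integral_nonneg fun ω => sq_nonneg _]
  congr 1
  simp_rw [sq, Finset.sum_mul_sum]
  rw [integral_finsetSum _ fun i _ => integrable_finsetSum _ fun j _ => hint i j]
  refine Finset.sum_congr rfl fun i _ => ?_
  rw [integral_finsetSum _ fun j _ => hint i j]
  exact Finset.sum_eq_single i (fun j _ hj => h0 i j hj.symm) (by simp)

/-- If the expected quadratic variations of a weak semi-martingale are bounded, then its
conditional variations are bounded in probability. -/
theorem IsWeakSemimartingaleWrt.exists_measure_lt_sum_condExp_le [IsProbabilityMeasure P]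
    (h : IsWeakSemimartingaleWrt X 𝓕 P) (hL : ∀ t, MemLp (X t) 2 P) {D : ℝ≥0}
    (hD : ∀ (n : ℕ) (t : Fin (n + 1) → Set.Icc (0 : ℝ≥0) T), Monotone t →
      ∑ j : Fin n, ∫⁻ ω, ‖(X (t j.succ) - X (t j.castSucc)) ω‖ₑ ^ 2 ∂P ≤ D)
    {ε : ℝ≥0∞} (hε : 0 < ε) :
    ∃ K : ℝ≥0, ∀ (n : ℕ) (t : Fin (n + 1) → Set.Icc (0 : ℝ≥0) T), Monotone t →
      P {ω | (K : ℝ) < ∑ j : Fin n,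
        |(P[X (t j.succ) - X (t j.castSucc) | 𝓕 (t j.castSucc)]) ω|} ≤ ε := by
  have hε2 := ENNReal.half_pos hε.ne'
  obtain ⟨c, hc0, hc⟩ := h.exists_measure_lt_integral_le hε2
  -- `r` is the Chebyshev threshold: $4D < r\,\varepsilon/2\le r^2\varepsilon/2$, since $r\ge1$.
  obtain ⟨r, hr⟩ := ENNReal.exists_nat_mul_gt hε2.ne' (b := 4 * D)
    (ENNReal.mul_ne_top (by simp) ENNReal.coe_ne_top)
  have hr0 : r ≠ 0 := by
    rintro rfl
    simp at hr
  refine ⟨c + r, fun n t ht => ?_⟩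
  let Δ : Fin n → Ω → ℝ := fun j => X (t j.succ) - X (t j.castSucc)
  let ξ : Fin n → Ω → ℝ := fun j => P[Δ j | 𝓕 (t j.castSucc)]
  -- The sign of `ξ j`, with value 1 at zero so that $|f_j|=1$ everywhere and `g j` has the same
  -- absolute value as `Δ j - ξ j`.
  let f : Fin n → Ω → ℝ := fun j ω => if 0 ≤ ξ j ω then 1 else -1
  let g : Fin n → Ω → ℝ := fun j ω => f j ω * (Δ j ω - ξ j ω)
  have hξm (j : Fin n) : Measurable[𝓕 (t j.castSucc)] (ξ j) :=
    stronglyMeasurable_condExp.measurable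
  have hfm (j : Fin n) : Measurable[𝓕 (t j.castSucc)] (f j) :=
    Measurable.ite (hξm j measurableSet_Ici) measurable_const measurable_const
  have hf1 (j : Fin n) (ω : Ω) : |f j ω| = 1 := by
    simp only [f]
    split_ifs <;> simp
  have hΔ (j : Fin n) : MemLp (Δ j) 2 P := (hL _).sub (hL _)
  have hξ (j : Fin n) : MemLp (ξ j) 2 P := (hΔ j).condExp one_le_two
  have hN (j : Fin n) : MemLp (Δ j - ξ j) 2 P := (hΔ j).sub (hξ j)
  have hgm {i j : Fin n} (hij : i < j) : Measurable[𝓕 (t j.castSucc)] (g i) := by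
    have hle : 𝓕 (t i.castSucc) ≤ 𝓕 (t j.castSucc) := 𝓕.mono (ht hij.le)
    have hle' : 𝓕 (t i.succ) ≤ 𝓕 (t j.castSucc) :=
      𝓕.mono (ht (Fin.succ_le_castSucc_iff.2 hij))
    exact ((hfm i).mono hle le_rfl).mul ((((h.1 _).mono hle' le_rfl).sub
      ((h.1 _).mono hle le_rfl)).sub ((hξm i).mono hle le_rfl))
  have hgabs (j : Fin n) (ω : Ω) : ‖g j ω‖ = ‖(Δ j - ξ j) ω‖ := by
    simp [g, hf1]
  have hg (j : Fin n) : MemLp (g j) 2 P := by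
    refine (hN j).of_le ?_ (ae_of_all _ fun ω => (hgabs j ω).le)
    have h1 := ((hfm j).mono (𝓕.le _) le_rfl)
    exact h1.aestronglyMeasurable.mul (hN j).1
  -- The factor $g_i f_j$ is known at time $t_j$, while `Δ j - ξ j` has zero conditional expectation
  -- there.
  have horth : ∀ i j, i < j → ∫ ω, g i ω * g j ω ∂P = 0 := by
    intro i j hij
    have hh : MemLp (fun ω => g i ω * f j ω) 2 P := by
      refine (hg i).of_le ((hg i).1.mul ((hfm j).mono (𝓕.le _) le_rfl).aestronglyMeasurable)
        (ae_of_all _ fun ω => ?_)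
      simp [hf1]
    have hN0 : P[Δ j - ξ j | 𝓕 (t j.castSucc)] =ᵐ[P] 0 := by
      have h1 := condExp_sub ((hΔ j).integrable one_le_two) ((hξ j).integrable one_le_two)
        (𝓕 (t j.castSucc))
      rw [condExp_of_stronglyMeasurable (𝓕.le _) (hξm j).stronglyMeasurable
        ((hξ j).integrable one_le_two)] at h1
      filter_upwards [h1] with ω hω
      rw [hω]
      simp [ξ]
    have hprod := condExp_mul_of_stronglyMeasurable_left (μ := P)
      (((hgm hij).mul (hfm j)).stronglyMeasurable) (hh.integrable_mul (hN j))
      ((hN j).integrable one_le_two)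
    calc ∫ ω, g i ω * g j ω ∂P = ∫ ω, ((fun ω => g i ω * f j ω) * (Δ j - ξ j)) ω ∂P := by
          refine integral_congr_ae (ae_of_all _ fun ω => ?_)
          simp [g, mul_assoc]
      _ = ∫ ω, (P[(fun ω => g i ω * f j ω) * (Δ j - ξ j) | 𝓕 (t j.castSucc)]) ω ∂P :=
          (integral_condExp (𝓕.le _)).symm
      _ = ∫ _, (0 : ℝ) ∂P := by
          refine integral_congr_ae ?_
          filter_upwards [hprod, hN0] with ω h1 h2
          exact h1.trans (by rw [Pi.mul_apply, h2, Pi.zero_apply, mul_zero])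
      _ = 0 := by simp
  have hg2 (j : Fin n) : ∫⁻ ω, ‖g j ω‖ₑ ^ 2 ∂P ≤ 4 * ∫⁻ ω, ‖Δ j ω‖ₑ ^ 2 ∂P := by
    rw [lintegral_enorm_sq_eq_eLpNorm_sq, lintegral_enorm_sq_eq_eLpNorm_sq,
      eLpNorm_congr_norm_ae (ae_of_all _ (hgabs j))]
    calc eLpNorm (Δ j - ξ j) 2 P ^ 2 ≤ (eLpNorm (Δ j) 2 P + eLpNorm (Δ j) 2 P) ^ 2 := by
          gcongr
          refine (eLpNorm_sub_le (hΔ j).1 (hξ j).1 one_le_two).trans ?_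
          gcongr
          exact eLpNorm_condExp_le_eLpNorm _ one_le_two
      _ = 4 * eLpNorm (Δ j) 2 P ^ 2 := by ring
  have hM : ∫⁻ ω, ‖∑ j, g j ω‖ₑ ^ 2 ∂P ≤ 4 * D := by
    rw [lintegral_enorm_sum_sq_of_orthogonal hg horth]
    refine (Finset.sum_le_sum fun j _ => hg2 j).trans ?_
    rw [← Finset.mul_sum]
    gcongr
    exact hD n t ht
  have hMr : P {ω | (r : ℝ) < |∑ j, g j ω|} ≤ ε / 2 := by
    have hmeas : AEMeasurable (fun ω => ‖∑ j, g j ω‖ₑ ^ 2) P := by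
      have := (memLp_finsetSum Finset.univ fun j _ => hg j).1.enorm
      exact this.pow_const 2
    have h1 := mul_meas_ge_le_lintegral₀ hmeas ((r : ℝ≥0∞) ^ 2)
    have h2 : P {ω | (r : ℝ) < |∑ j, g j ω|} ≤ P {ω | (r : ℝ≥0∞) ^ 2 ≤ ‖∑ j, g j ω‖ₑ ^ 2} := by
      refine measure_mono fun ω hω => ?_
      simp only [Set.mem_ofPred_eq] at hω ⊢
      gcongr
      rw [← ofReal_norm, Real.norm_eq_abs, ← ENNReal.ofReal_natCast]
      exact ENNReal.ofReal_le_ofReal hω.le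
    have hr0' : (r : ℝ≥0∞) ≠ 0 := by simpa using hr0
    refine h2.trans ((ENNReal.mul_le_mul_iff_right (pow_ne_zero 2 hr0')
      (ENNReal.pow_ne_top (ENNReal.natCast_ne_top r))).1 ?_)
    refine (h1.trans (hM.trans hr.le)).trans ?_
    gcongr
    exact le_self_pow₀ (by exact_mod_cast Nat.one_le_iff_ne_zero.2 hr0) two_ne_zero
  let θ : ElementaryIntegrand 𝓕 P :=
    { n := n
      time := t
      time_mono := ht
      coeff := f
      coeff_measurable := hfm
      coeff_bound := fun j => ae_of_all _ fun ω => (hf1 j ω).le }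
  have hθ (ω : Ω) : ∑ j, |ξ j ω| = θ.integral X ω - ∑ j, g j ω := by
    have : θ.integral X ω = ∑ j, f j ω * Δ j ω := rfl
    rw [this, ← Finset.sum_sub_distrib]
    refine Finset.sum_congr rfl fun j _ => ?_
    simp only [g, f]
    split_ifs with hle
    · rw [abs_of_nonneg hle]; ring
    · rw [abs_of_neg (not_le.1 hle)]; ring
  calc P {ω | ((c + r : ℝ≥0) : ℝ) < ∑ j, |ξ j ω|}
      ≤ P ({ω | (c : ℝ) < |θ.integral X ω|} ∪ {ω | (r : ℝ) < |∑ j, g j ω|}) := by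
        refine measure_mono fun ω hω => ?_
        by_contra hcon
        simp only [Set.mem_union, Set.mem_ofPred_eq, not_or, not_lt] at hcon hω
        rw [hθ] at hω
        push_cast at hω
        have h1 := (abs_le.1 hcon.1).2
        have h2 := (abs_le.1 hcon.2).1
        linarith
    _ ≤ ε / 2 + ε / 2 := (measure_union_le _ _).trans (add_le_add (hc θ) hMr)
    _ = ε := ENNReal.add_halves ε

/-- A centered Gaussian weak semi-martingale is a quasi-martingale. -/
theorem IsWeakSemimartingale.isQuasimartingale [IsProbabilityMeasure P]
    {hX : ∀ t, StronglyMeasurable (X t)} (h : IsWeakSemimartingale X hX P)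
    (hG : IsGaussianProcess X P) (h0 : ∀ t, ∫ ω, X t ω ∂P = 0) : IsQuasimartingale X hX P := by
  have hL (t) : MemLp (X t) 2 P := (hG.hasGaussianLaw_eval t).memLp_two
  refine ⟨fun t => (hL t).mono_exponent one_le_two, ?_⟩
  have hincr (s u) : IsCenteredGaussian (X u - X s) P := by
    refine isCenteredGaussian_of_hasGaussianLaw hG.hasGaussianLaw_sub ?_
    simp only [Pi.sub_apply]
    rw [integral_sub ((hL u).integrable one_le_two) ((hL s).integrable one_le_two), h0, h0,
      sub_zero]
  have hcond (s u) : IsCenteredGaussian (P[X u - X s | Filtration.natural X hX s]) P := by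
    have h1 := isCenteredGaussian_condExp (fun t => (hX t).measurable) hG h0 (Set.Iic s) u s
    have h2 : Filtration.natural X hX s
        = ⨆ i : Set.Iic s, MeasurableSpace.comap (X i) (borel ℝ) := by
      rw [iSup_subtype]
      simp [Filtration.natural, BorelSpace.measurable_eq (α := ℝ)]
    rwa [h2]
  -- Power 2 makes the expected quadratic variation bounded; power 1, below, does the same for the
  -- conditional variation. Each time boundedness in probability is used only at the single level δ.
  obtain ⟨δ, hδ, hδ'⟩ := exists_sum_eLpNorm_le 2 P
  obtain ⟨K, hK⟩ := IsWeakSemimartingaleWrt.exists_measure_lt_sum_sq_le h hδ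
  have hD (n : ℕ) (t : Fin (n + 1) → Set.Icc (0 : ℝ≥0) T) (ht : Monotone t) :
      ∑ j : Fin n, ∫⁻ ω, ‖(X (t j.succ) - X (t j.castSucc)) ω‖ₑ ^ 2 ∂P ≤ (2 * K : ℝ≥0) := by
    have := hδ' n (fun j => X (t j.succ) - X (t j.castSucc)) (fun j => hincr _ _) K (hK n t ht)
    simpa [eLpNorm_one_eq_lintegral_enorm, enorm_pow] using this
  obtain ⟨δ₁, hδ₁, hδ₁'⟩ := exists_sum_eLpNorm_le 1 P
  obtain ⟨K₁, hK₁⟩ := IsWeakSemimartingaleWrt.exists_measure_lt_sum_condExp_le h hL hD hδ₁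
  refine lt_of_le_of_lt (iSup_le fun τ => ?_) (show (2 * K₁ : ℝ≥0∞) < ∞ from
    ENNReal.mul_lt_top (by simp) (by simp))
  have := hδ₁' τ.n
    (fun j => P[X (τ.time j.succ) - X (τ.time j.castSucc) |
      Filtration.natural X hX (τ.time j.castSucc)]) (fun j => hcond _ _) K₁
    (by simpa using hK₁ τ.n τ.time τ.time_strictMono.monotone)
  simpa [eLpNorm_one_eq_lintegral_enorm] using this

end WeakSemimartingale

/-! ### The sub-mixed process is centered Gaussian. -/

section GaussianSubMixed

variable {Ω : Type*} {m : MeasurableSpace Ω} {P : Measure Ω}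

theorem isGaussianProcess_add_of_indepFun {ι : Type*} {X Y : ι → Ω → ℝ}
    (hX : IsGaussianProcess X P) (hY : IsGaussianProcess Y P)
    (h : IndepFun (fun ω i => X i ω) (fun ω i => Y i ω) P) :
    IsGaussianProcess (fun i ω => X i ω + Y i ω) P where
  hasGaussianLaw I :=
    iIndepFun.hasGaussianLaw_fun_add (hX.hasGaussianLaw I) (hY.hasGaussianLaw I)
      (h.comp (Finset.measurable_restrict I) (Finset.measurable_restrict I))

theorem isGaussianProcess_add_neg {Y : ℝ → Ω → ℝ} (hY : IsGaussianProcess Y P) :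
    IsGaussianProcess (fun (t : ℝ≥0) ω => Y t ω + Y (-(t : ℝ)) ω) P :=
  hY.of_isGaussianProcess fun t => by
    classical
    exact ⟨{(t : ℝ), -(t : ℝ)},
      { toFun x := x ⟨t, by simp⟩ + x ⟨-(t : ℝ), by simp⟩
        map_add' x y := by simp; ring
        map_smul' c x := by simp; ring },
      by simp⟩

variable {H a b : ℝ} {B BH : ℝ → Ω → ℝ}

/-- The two Brownian halves are combined through their independence, the two values of `BH` through
a linear map of one Gaussian process, and the two resulting sums through the independence of `B` and
`BH`. -/
theorem isGaussianProcess_smfBm (hB : IsTwoSidedPreBrownian B P)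
    (hBH : IsFractionalBrownianMotion H BH P)
    (hindep : IndepFun (fun ω (t : ℝ) => B t ω) (fun ω (t : ℝ) => BH t ω) P) :
    IsGaussianProcess (smfBm a b B BH) P := by
  have h1 : IsGaussianProcess (fun (t : ℝ≥0) ω => B t ω + B (-(t : ℝ)) ω) P :=
    isGaussianProcess_add_of_indepFun hB.forward.isGaussianProcess hB.backward.isGaussianProcess
      hB.indep
  have h2 := isGaussianProcess_add_neg hBH.gaussian
  have h3 := hindep.comp (φ := fun x (t : ℝ≥0) => a * (x t + x (-(t : ℝ))))
    (ψ := fun x (t : ℝ≥0) => b * (x t + x (-(t : ℝ)))) (by fun_prop) (by fun_prop)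
  have h4 := isGaussianProcess_add_of_indepFun (h1.smul fun _ => a) (h2.smul fun _ => b) h3
  refine (h4.smul fun _ => (√2)⁻¹).congr fun t => ae_of_all _ fun ω => ?_
  simp only [smfBm, div_eq_inv_mul, smul_eq_mul]

theorem integral_smfBm (hB : IsTwoSidedPreBrownian B P)
    (hBH : IsFractionalBrownianMotion H BH P) (t : ℝ≥0) :
    ∫ ω, smfBm a b B BH t ω ∂P = 0 := by
  have i1 := hB.forward.integrable_eval t
  have i2 := hB.backward.integrable_eval t
  have i3 (s : ℝ) : Integrable (BH s) P := (hBH.gaussian.hasGaussianLaw_eval s).integrable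
  have e1 := hB.forward.integral_eval t
  have e2 := hB.backward.integral_eval t
  have e3 : ∫ ω, (B t ω + B (-(t : ℝ)) ω) ∂P = 0 := by
    rw [integral_add i1 i2, e1, e2, add_zero]
  have e4 : ∫ ω, (BH t ω + BH (-(t : ℝ)) ω) ∂P = 0 := by
    rw [integral_add (i3 _) (i3 _), hBH.centered, hBH.centered, add_zero]
  have e5 : ∫ ω, (a * (B t ω + B (-(t : ℝ)) ω) + b * (BH t ω + BH (-(t : ℝ)) ω)) ∂P = 0 := by
    rw [integral_add (f := fun ω => a * (B t ω + B (-(t : ℝ)) ω))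
      (g := fun ω => b * (BH t ω + BH (-(t : ℝ)) ω)) ((i1.add i2).const_mul a)
      (((i3 _).add (i3 _)).const_mul b), integral_const_mul, integral_const_mul, e3, e4]
    simp
  simp only [smfBm]
  rw [integral_div, e5, zero_div]

end GaussianSubMixed

end SubMixed

theorem mainTheorem5 {Ω : Type*} [MeasurableSpace Ω] (P : Measure Ω) [IsProbabilityMeasure P]
    (H a b : ℝ) (hH0 : 0 < H) (hH1 : H < 1) (hab : (a, b) ≠ (0, 0))
    (B BH : ℝ → Ω → ℝ)
    (hB : SubMixed.IsTwoSidedPreBrownian B P)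
    (hBH : SubMixed.IsFractionalBrownianMotion H BH P)
    (hindep : IndepFun (fun ω (t : ℝ) => B t ω) (fun ω (t : ℝ) => BH t ω) P)
    (T : ℝ≥0) (hT : 0 < T)
    (hS : ¬ SubMixed.IsQuasimartingale (SubMixed.smfBmOn a b B BH T)
      (SubMixed.stronglyMeasurable_smfBmOn a b hB.measurable hBH.measurable T) P) :
    ¬ SubMixed.IsWeakSemimartingale (SubMixed.smfBmOn a b B BH T)
      (SubMixed.stronglyMeasurable_smfBmOn a b hB.measurable hBH.measurable T) P := by
  intro h
  exact hS (h.isQuasimartingale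
    ((SubMixed.isGaussianProcess_smfBm hB hBH hindep).comp_right Subtype.val)
    fun t => SubMixed.integral_smfBm hB hBH t)
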